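/- Consider a hybrid access point with $N\ge 2$ antennas, a single-antenna user and a single-antenna relay. Let $\mathbf h_1,\mathbf h_2\in\mathbb C^N$ be the user-to-access-point and relay-to-access-point channels and $h_3\in\mathbb C$ the user-to-relay channel; all $2N+1$ channel coefficients are independent with law $\mathcal{CN}(0,1)$. Let $d_1,d_2,d_3>0$ be the access-point-to-user, access-point-to-relay and user-to-relay distances, $\alpha$ the path loss exponent, $\eta>0$ the energy conversion efficiency, $\tau\in(0,1)$ the time split and $\rho=P_s/N_0>0$ the ratio of the transmit power of the access point to the noise power. With energy beamforming vector $\mathbf w$ at the access point, and with maximal ratio combining of the direct link and the amplify-and-forward relay link, the end-to-end SNR is $$\gamma(\rho)=\gamma_{us}+\frac{\gamma_{ur}\,\gamma_{rs}}{\gamma_{ur}+\gamma_{rs}+1},$$ $$\gamma_{us}=\frac{2\eta\tau\rho\,|\mathbf h_1^T\mathbf w|^2\|\mathbf h_1\|^2}{(1-\tau)d_1^{2\alpha}},\qquad \gamma_{ur}=\frac{2\eta\tau\rho\,|\mathbf h_1^T\mathbf w|^2|h_3|^2}{(1-\tau)d_1^{\alpha}d_3^{\alpha}},\qquad \gamma_{rs}=\frac{2\eta\tau\rho\,|\mathbf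 h_2^T\mathbf w|^2\|\mathbf h_2\|^2}{(1-\tau)d_2^{2\alpha}}.$$ Let the beamforming be maximum ratio transmission (MRT) towards the user, $\mathbf w=\mathbf h_1^*/\|\mathbf h_1\|$, let $\gamma_{th}>0$ be a fixed threshold, and let $P_{out}(\rho)=\mathbb P(\gamma(\rho)<\gamma_{th})$ be the outage probability. Then, as $\rho\to\infty$ with all other parameters fixed, $P_{out}(\rho)\sim P_{out}^{\infty}(\rho)$, i.e. the ratio of the two sides tends to $1$, where $$P_{out}^{\infty}(\rho)=\frac{2d_3^{\alpha}}{d_1^{\alpha}\,\Gamma(N)(N+1)(N-1)}\left[\frac{(1-\tau)d_1^{2\alpha}\gamma_{th}}{2\eta\tau\rho}\right]^{\frac{N+1}{2}}.$$ Consequently the system has diversity order $\frac{N+1}{2}$, i.e. $\displaystyle\lim_{\rho\to\infty}\frac{-\log P_{out}(\rho)}{\log\rho}=\frac{N+1}{2}$. -/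

import Mathlib

open Filter Topology MeasureTheory ProbabilityTheory Asymptotics

noncomputable section

namespace WirelessPowered

/-- The law `CN(0,1)` on `ℂ`: real and imaginary parts are independent, centred Gaussian of
variance `1/2`. -/
def complexNormal : Measure ℂ :=
  ((gaussianReal 0 (1 / 2)).prod (gaussianReal 0 (1 / 2))).map
    (fun p : ℝ × ℝ => (⟨p.1, p.2⟩ : ℂ))

/-- Rayleigh fading: all entries of the channel vectors `h₁` (user to access point) and `h₂`
(relay to access point), and the scalar channel `h₃` (user to relay), are independent with law
`CN(0,1)`; that is, the joint law is the product of `2 N + 1` copies of `CN(0,1)`. -/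
def IsRayleighChannel {Ω : Type*} [MeasurableSpace Ω] (P : Measure Ω) {N : ℕ}
    (h₁ h₂ : Ω → Fin N → ℂ) (h₃ : Ω → ℂ) : Prop :=
  HasLaw (fun ω => (h₁ ω, h₂ ω, h₃ ω))
    ((Measure.pi fun _ : Fin N => complexNormal).prod
      ((Measure.pi fun _ : Fin N => complexNormal).prod complexNormal)) P

/-- The Euclidean (Frobenius) norm of a complex vector. -/
def vecNorm {N : ℕ} (h : Fin N → ℂ) : ℝ := Real.sqrt (∑ i, ‖h i‖ ^ 2)

/-- Maximum ratio transmission along `h`: the beamforming vector `h* / ‖h‖`. -/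
def mrt {N : ℕ} (h : Fin N → ℂ) : Fin N → ℂ := fun i => star (h i) / (vecNorm h : ℂ)

/-- The deterministic parameters of the system: energy conversion efficiency `η`, time split `τ`,
path loss exponent `α`, and the distances `d₁` (access point to user), `d₂` (access point to
relay), `d₃` (user to relay). -/
structure Params where
  η : ℝ
  τ : ℝ
  α : ℝ
  d₁ : ℝ
  d₂ : ℝ
  d₃ : ℝ

namespace Params

variable (S : Params)

/-- The transmit power, divided by the noise power, of a node at distance `d` from the access
point that harvests energy during the fraction `τ` of the block through the channel `h` with the
beamforming vector `w`, and spends it during the fraction `(1 - τ) / 2` of the block. Here `ρ` is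
the transmit power of the access point divided by the noise power. -/
def txSNR {N : ℕ} (ρ d : ℝ) (h w : Fin N → ℂ) : ℝ :=
  S.η * S.τ * ρ * ‖h ⬝ᵥ w‖ ^ 2 / d ^ S.α / ((1 - S.τ) / 2)

/-- SNR of the direct link from the user to the access point. -/
def directSNR {N : ℕ} (ρ : ℝ) (h₁ w : Fin N → ℂ) : ℝ :=
  S.txSNR ρ S.d₁ h₁ w / S.d₁ ^ S.α * vecNorm h₁ ^ 2

/-- SNR of the hop from the user to the relay. -/
def userRelaySNR {N : ℕ} (ρ : ℝ) (h₁ : Fin N → ℂ) (h₃ : ℂ) (w : Fin N → ℂ) : ℝ :=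
  S.txSNR ρ S.d₁ h₁ w / S.d₃ ^ S.α * ‖h₃‖ ^ 2

/-- SNR of the hop from the relay to the access point. -/
def relayAPSNR {N : ℕ} (ρ : ℝ) (h₂ w : Fin N → ℂ) : ℝ :=
  S.txSNR ρ S.d₂ h₂ w / S.d₂ ^ S.α * vecNorm h₂ ^ 2

/-- End-to-end SNR at the access point: maximal ratio combining of the direct link and of the
amplify-and-forward relay link. -/
def endToEndSNR {N : ℕ} (ρ : ℝ) (h₁ h₂ : Fin N → ℂ) (h₃ : ℂ) (w : Fin N → ℂ) : ℝ :=
  S.directSNR ρ h₁ w +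
    S.userRelaySNR ρ h₁ h₃ w * S.relayAPSNR ρ h₂ w /
      (S.userRelaySNR ρ h₁ h₃ w + S.relayAPSNR ρ h₂ w + 1)

/-- The outage probability: the probability that the end-to-end SNR is below `γth`, where the
beamforming vector `w` may depend on the channels. -/
def outageProb {Ω : Type*} [MeasurableSpace Ω] (P : Measure Ω) {N : ℕ}
    (h₁ h₂ : Ω → Fin N → ℂ) (h₃ : Ω → ℂ) (w : Ω → Fin N → ℂ) (γth ρ : ℝ) : ℝ :=
  P.real {ω | S.endToEndSNR ρ (h₁ ω) (h₂ ω) (h₃ ω) (w ω) < γth}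

/-- The high-SNR expression for the outage probability. -/
def outageProbInf (N : ℕ) (γth ρ : ℝ) : ℝ :=
  2 * S.d₃ ^ S.α / (S.d₁ ^ S.α * Real.Gamma N * ((N : ℝ) + 1) * ((N : ℝ) - 1)) *
    ((1 - S.τ) * S.d₁ ^ (2 * S.α) * γth / (2 * S.η * S.τ * ρ)) ^ (((N : ℝ) + 1) / 2)

end Params

/-- `p`, an outage probability as a function of the SNR `ρ`, has diversity order `d`:
`- log p(ρ) / log ρ → d` as `ρ → ∞`. -/
def HasDiversityOrder (p : ℝ → ℝ) (d : ℝ) : Prop :=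
  Tendsto (fun ρ => -Real.log (p ρ) / Real.log ρ) atTop (𝓝 d)

end WirelessPowered

end

/-!
# High-SNR outage of the wireless-powered relay link under maximum ratio transmission

With `w = h₁* / ‖h₁‖`, write `X = ‖h₁‖²`, `Z = |h₃|²` and `Y = |h₂ᵀ w|² ‖h₂‖²`. After division by
the SNR scale of the direct link, outage reads `X² + A B / (A + B + ε / γ) < ε` with `A = a X Z` and
`B = b Y`, where `ε = δ²` is proportional to `1 / ρ`. The second hop does not matter to leading
order, so the outage event is squeezed between events of the form `a X Z < λ (ε - X²)`, in which
that hop is absent.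

* The lower bound has `λ = 1`, since the relay link is never better than its first hop
  (`leadingEvent_subset_outageEvent`).
* The upper bound has `λ = (M + 1 / γ) / (M - 1)`, up to the event that `X < δ` and `b Y < M ε`
  (`outageEvent_subset`). The latter has probability `O(δ ^ N · δ ^ (4/3))`: given `h₁`, one of the
  two factors of `Y` must be small, and the unit linear form `h₂ᵀ w` has bounded density
  (`channelLaw_weakRelayEvent_le`). This is `o(δ ^ (N + 1))` because `N ≥ 2`.

For the leading term, `X` has the law `Gamma(N)` (`lintegral_sum_normSq`) and `Z` is exponential.
Substituting `x = δ s` and using dominated convergence, the probability of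
`X < δ`, `a X Z < λ (ε - X²)`, divided by `δ ^ (N + 1)`, tends to `λ / (a Γ(N)) ∫₀¹ s ^ (N - 2) (1 - s²) ds = 2 λ / (a Γ(N) (N - 1) (N + 1))`
(`tendsto_channelLaw_leadingEvent`). Letting `M → ∞`, hence `λ → 1`, yields the equivalence, and the
diversity order is the exponent of `1 / ρ` in it.
-/

open scoped ENNReal

namespace WirelessPowered

/-! ### The complex normal law -/

instance : IsProbabilityMeasure complexNormal := by
  unfold complexNormal
  exact Measure.isProbabilityMeasure_map
    (Complex.measurableEquivRealProd.symm.measurable.aemeasurable)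

theorem complexNormal_eq_withDensity :
    complexNormal =
      volume.withDensity fun z : ℂ => ENNReal.ofReal (Real.pi⁻¹ * Real.exp (-‖z‖ ^ 2)) := by
  refine Measure.ext_of_lintegral _ fun f hf => ?_
  have hm : Measurable fun z : ℂ => ENNReal.ofReal (Real.pi⁻¹ * Real.exp (-‖z‖ ^ 2)) := by
    fun_prop
  have hv : (1 / 2 : NNReal) ≠ 0 := by norm_num
  rw [lintegral_withDensity_eq_lintegral_mul _ hm hf]
  change ∫⁻ a, f a ∂(Measure.map Complex.measurableEquivRealProd.symm _) = _
  rw [lintegral_map_equiv, gaussianReal_of_var_ne_zero _ hv,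
    prod_withDensity (measurable_gaussianPDF _ _) (measurable_gaussianPDF _ _),
    lintegral_withDensity_eq_lintegral_mul _ (by fun_prop) (by fun_prop),
    ← Complex.volume_preserving_equiv_real_prod.symm.lintegral_comp_emb
      Complex.measurableEquivRealProd.symm.measurableEmbedding, ← Measure.volume_eq_prod]
  refine lintegral_congr fun p => ?_
  simp only [Pi.mul_apply, gaussianPDF]
  congr 1
  rw [← ENNReal.ofReal_mul (gaussianPDFReal_nonneg _ _ _)]
  congr 1
  have h2 : (2 * Real.pi * ((1 / 2 : NNReal) : ℝ)) = Real.pi := by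
    push_cast; ring
  have h3 : (2 * ((1 / 2 : NNReal) : ℝ)) = 1 := by push_cast; norm_num
  simp only [gaussianPDFReal, h2, h3, sub_zero, div_one]
  have hn : ‖Complex.measurableEquivRealProd.symm p‖ ^ 2 = p.1 ^ 2 + p.2 ^ 2 := by
    rw [← Complex.normSq_eq_norm_sq, Complex.normSq_apply]
    simp [Complex.measurableEquivRealProd, sq]
  rw [hn, mul_mul_mul_comm, ← Real.exp_add, ← mul_inv, Real.mul_self_sqrt Real.pi_pos.le]
  ring_nf

/-- The squared modulus of a `CN(0,1)` variable is exponentially distributed with rate `1`. -/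
theorem lintegral_normSq_complexNormal {f : ℝ → ℝ≥0∞} (hf : Measurable f) :
    ∫⁻ z, f (‖z‖ ^ 2) ∂complexNormal =
      ∫⁻ x in Set.Ioi (0 : ℝ), ENNReal.ofReal (Real.exp (-x)) * f x := by
  have himg : (fun x : ℝ => x ^ 2) '' Set.Ioi 0 = Set.Ioi 0 := by
    ext x
    constructor
    · rintro ⟨y, hy, rfl⟩
      exact pow_pos (Set.mem_Ioi.1 hy) 2
    · intro hx
      exact ⟨√x, Real.sqrt_pos.2 hx, Real.sq_sqrt (le_of_lt hx)⟩
  have hinj : Set.InjOn (fun x : ℝ => x ^ 2) (Set.Ioi 0) := fun x hx y hy h =>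
    (pow_left_inj₀ (le_of_lt hx) (le_of_lt hy) two_ne_zero).1 h
  rw [complexNormal_eq_withDensity,
    lintegral_withDensity_eq_lintegral_mul _ (by fun_prop) (by fun_prop),
    ← Complex.lintegral_comp_polarCoord_symm]
  conv_rhs => rw [← himg]
  rw [lintegral_image_eq_lintegral_abs_deriv_mul (f' := fun x => 2 * x) measurableSet_Ioi
    (fun x _ => by simpa using (hasDerivAt_pow 2 x).hasDerivWithinAt) hinj,
    polarCoord_target, Measure.volume_eq_prod, ← Measure.prod_restrict, lintegral_prod _
    (by simp only [Pi.mul_apply, Complex.norm_polarCoord_symm]; fun_prop)]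
  refine setLIntegral_congr_fun measurableSet_Ioi fun x hx => ?_
  have hx : 0 < x := hx
  simp only [Pi.mul_apply, Complex.norm_polarCoord_symm, sq_abs, lintegral_const,
    Measure.restrict_apply_univ, Real.volume_Ioo, smul_eq_mul]
  have hpi := Real.pi_pos
  rw [sub_neg_eq_add, ← two_mul, mul_comm, ← mul_assoc, ← mul_assoc, ← mul_assoc,
    ← ENNReal.ofReal_mul (by positivity), ← ENNReal.ofReal_mul (by positivity),
    ← ENNReal.ofReal_mul (abs_nonneg _), abs_of_pos (by positivity)]
  congr 2
  field_simp

theorem complexNormal_normSq_lt (t : ℝ) :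
    complexNormal {z | ‖z‖ ^ 2 < t} = ENNReal.ofReal (1 - Real.exp (-t)) := by
  rcases le_or_gt t 0 with ht | ht
  · have : {z : ℂ | ‖z‖ ^ 2 < t} = ∅ := by
      ext z
      simpa using ht.trans (sq_nonneg _)
    rw [this, measure_empty, ENNReal.ofReal_of_nonpos]
    have := Real.add_one_le_exp (-t)
    linarith
  have h := lintegral_normSq_complexNormal
    (f := (Set.Iio t).indicator fun _ => 1) (measurable_const.indicator measurableSet_Iio)
  have hl : (fun z : ℂ => (Set.Iio t).indicator (fun _ => (1 : ℝ≥0∞)) (‖z‖ ^ 2)) =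
      {z : ℂ | ‖z‖ ^ 2 < t}.indicator fun _ => 1 := rfl
  have hr : (fun x : ℝ => ENNReal.ofReal (Real.exp (-x)) *
      (Set.Iio t).indicator (fun _ => (1 : ℝ≥0∞)) x) =
      (Set.Iio t).indicator fun x => ENNReal.ofReal (Real.exp (-x)) := by
    ext x
    by_cases hx : x ∈ Set.Iio t <;> simp [hx]
  rw [hl, hr, lintegral_indicator_const (measurableSet_lt (by fun_prop) measurable_const), one_mul,
    lintegral_indicator measurableSet_Iio, Measure.restrict_restrict measurableSet_Iio,
    Set.Iio_inter_Ioi, ← ofReal_integral_eq_lintegral_ofReal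
      ((Continuous.integrableOn_Icc (by fun_prop)).mono_set Set.Ioo_subset_Icc_self)
      (ae_of_all _ fun x => (Real.exp_pos _).le),
    ← integral_Ioc_eq_integral_Ioo, ← intervalIntegral.integral_of_le ht.le] at h
  rw [h, intervalIntegral.integral_comp_neg (fun x => Real.exp x)]
  simp

theorem complexNormal_ball_le (c : ℂ) {r : ℝ} (hr : 0 ≤ r) :
    complexNormal (Metric.ball c r) ≤ ENNReal.ofReal (r ^ 2) := by
  rw [complexNormal_eq_withDensity, withDensity_apply _ measurableSet_ball]
  calc ∫⁻ z in Metric.ball c r, ENNReal.ofReal (Real.pi⁻¹ * Real.exp (-‖z‖ ^ 2))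
      ≤ ∫⁻ _ in Metric.ball c r, ENNReal.ofReal Real.pi⁻¹ := by
        refine lintegral_mono fun z => ENNReal.ofReal_le_ofReal ?_
        refine mul_le_of_le_one_right (by have := Real.pi_pos; positivity) ?_
        exact Real.exp_le_one_iff.2 (by nlinarith [norm_nonneg z])
    _ = ENNReal.ofReal (r ^ 2) := by
        rw [setLIntegral_const, Complex.volume_ball, ← ENNReal.ofReal_pow hr,
          ← ENNReal.ofReal_coe_nnreal, ← ENNReal.ofReal_mul (by positivity),
          ← ENNReal.ofReal_mul (by have := Real.pi_pos; positivity)]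
        congr 1
        simp only [NNReal.coe_real_pi]
        field_simp

/-! ### The Gamma law of the channel gain -/

theorem integral_sub_pow (n : ℕ) (s : ℝ) :
    ∫ y in (0 : ℝ)..s, (s - y) ^ n / n.factorial = s ^ (n + 1) / (n + 1).factorial := by
  rw [intervalIntegral.integral_comp_sub_left (fun y => y ^ n / (n.factorial : ℝ))]
  simp only [sub_self, sub_zero, intervalIntegral.integral_div, integral_pow, Nat.factorial_succ]
  push_cast
  field_simp
  simp

/-- Adding an independent exponential variable to a `Gamma(n+1)` variable yields a `Gamma(n+2)`
variable. -/
theorem lintegral_gamma_add_exp (n : ℕ) {f : ℝ → ℝ≥0∞} (hf : Measurable f) :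
    ∫⁻ y in Set.Ioi (0 : ℝ), ENNReal.ofReal (Real.exp (-y)) *
        ∫⁻ x in Set.Ioi (0 : ℝ), ENNReal.ofReal (x ^ n / n.factorial * Real.exp (-x)) * f (y + x) =
      ∫⁻ s in Set.Ioi (0 : ℝ),
        ENNReal.ofReal (s ^ (n + 1) / (n + 1).factorial * Real.exp (-s)) * f s := by
  -- the integrand in the variables `y` and `s = y + x`
  let F : ℝ → ℝ → ℝ≥0∞ := fun y s => (Set.Ioi (0 : ℝ)).indicator 1 y *
    ((Set.Ioi (0 : ℝ)).indicator 1 (s - y) *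
      (ENNReal.ofReal ((s - y) ^ n / n.factorial) * (ENNReal.ofReal (Real.exp (-s)) * f s)))
  have hF : Measurable (Function.uncurry F) := by
    have h1 : Measurable ((Set.Ioi (0 : ℝ)).indicator (1 : ℝ → ℝ≥0∞)) :=
      measurable_one.indicator measurableSet_Ioi
    unfold F Function.uncurry
    fun_prop
  calc _ = ∫⁻ y, ∫⁻ s, F y s := by
        rw [← lintegral_indicator measurableSet_Ioi]
        refine lintegral_congr fun y => ?_
        by_cases hy : y ∈ Set.Ioi (0 : ℝ)
        · rw [Set.indicator_of_mem hy, ← lintegral_indicator measurableSet_Ioi,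
            ← lintegral_const_mul' _ _ ENNReal.ofReal_ne_top, ← lintegral_sub_right_eq_self _ y]
          refine lintegral_congr fun s => ?_
          by_cases hs : s - y ∈ Set.Ioi (0 : ℝ)
          · simp only [F, Set.indicator_of_mem hy, Set.indicator_of_mem hs, Pi.one_apply, one_mul,
              add_sub_cancel]
            have hs' : 0 < s - y := hs
            rw [← mul_assoc, ← mul_assoc, ← ENNReal.ofReal_mul (by positivity),
              ← ENNReal.ofReal_mul (by positivity), mul_left_comm, ← Real.exp_add]
            congr 4
            ring
          · simp [F, Set.indicator_of_notMem hs]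
        · simp [F, Set.indicator_of_notMem hy]
    _ = ∫⁻ s, ∫⁻ y, F y s := lintegral_lintegral_swap hF.aemeasurable
    _ = _ := by
        rw [← lintegral_indicator measurableSet_Ioi]
        refine lintegral_congr fun s => ?_
        have hFs : ∀ y, F y s = (Set.Ioo (0 : ℝ) s).indicator
            (fun y => ENNReal.ofReal ((s - y) ^ n / n.factorial)) y *
              (ENNReal.ofReal (Real.exp (-s)) * f s) := by
          intro y
          by_cases hy : 0 < y <;> by_cases hs : y < s <;>
            simp [F, Set.indicator, hy, hs]
        simp_rw [hFs]
        have hmeas : Measurable fun y : ℝ => ENNReal.ofReal ((s - y) ^ n / n.factorial) := by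
          fun_prop
        rw [lintegral_mul_const _ (hmeas.indicator measurableSet_Ioo),
          lintegral_indicator measurableSet_Ioo]
        by_cases hs : s ∈ Set.Ioi (0 : ℝ)
        · have hs' : 0 < s := hs
          rw [Set.indicator_of_mem hs, ← ofReal_integral_eq_lintegral_ofReal
            ((Continuous.integrableOn_Icc (by fun_prop)).mono_set Set.Ioo_subset_Icc_self)
            ((ae_restrict_mem measurableSet_Ioo).mono fun y hy => div_nonneg
              (pow_nonneg (sub_nonneg.2 hy.2.le) n) (Nat.cast_nonneg _)),
            ← integral_Ioc_eq_integral_Ioo, ← intervalIntegral.integral_of_le hs'.le,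
            integral_sub_pow, ← mul_assoc, ← ENNReal.ofReal_mul (by positivity)]
        · rw [Set.indicator_of_notMem hs, Set.Ioo_eq_empty (by simpa using hs)]
          simp

/-- The squared norm of a vector of `n + 1` independent `CN(0,1)` variables has the law
`Gamma(n + 1)`. -/
theorem lintegral_sum_normSq (n : ℕ) {f : ℝ → ℝ≥0∞} (hf : Measurable f) :
    ∫⁻ h, f (∑ i, ‖h i‖ ^ 2) ∂(Measure.pi fun _ : Fin (n + 1) => complexNormal) =
      ∫⁻ x in Set.Ioi (0 : ℝ), ENNReal.ofReal (x ^ n / n.factorial * Real.exp (-x)) * f x := by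
  have hsplit : ∀ (m : ℕ) {g : ℝ → ℝ≥0∞}, Measurable g →
      ∫⁻ h, g (∑ i, ‖h i‖ ^ 2) ∂(Measure.pi fun _ : Fin (m + 1) => complexNormal) =
        ∫⁻ z, ∫⁻ h, g (‖z‖ ^ 2 + ∑ i, ‖h i‖ ^ 2)
          ∂(Measure.pi fun _ : Fin m => complexNormal) ∂complexNormal := by
    intro m g hg
    rw [← lintegral_prod (fun p : ℂ × (Fin m → ℂ) => g (‖p.1‖ ^ 2 + ∑ i, ‖p.2 i‖ ^ 2))
      (by fun_prop), ← (measurePreserving_piFinSuccAbove (fun _ => complexNormal) 0).lintegral_comp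
      (by fun_prop)]
    refine lintegral_congr fun h => ?_
    rw [Fin.sum_univ_succ]
    rfl
  induction n generalizing f with
  | zero =>
    rw [hsplit 0 hf]
    simpa using lintegral_normSq_complexNormal hf
  | succ n ih =>
    rw [hsplit (n + 1) hf]
    simp_rw [fun z : ℂ => ih (f := fun x => f (‖z‖ ^ 2 + x)) (by fun_prop)]
    rw [lintegral_normSq_complexNormal (f := fun y => ∫⁻ x in Set.Ioi (0 : ℝ),
      ENNReal.ofReal (x ^ n / n.factorial * Real.exp (-x)) * f (y + x))
      (Measurable.lintegral_prod_right' (f := fun p : ℝ × ℝ =>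
        ENNReal.ofReal (p.2 ^ n / n.factorial * Real.exp (-p.2)) * f (p.1 + p.2)) (by fun_prop)),
      lintegral_gamma_add_exp n hf]

/-! ### Small-ball estimates for the channel vectors -/

theorem pi_complexNormal_sum_normSq_lt_le (N : ℕ) (r : ℝ) :
    (Measure.pi fun _ : Fin N => complexNormal) {h | ∑ i, ‖h i‖ ^ 2 < r} ≤ ENNReal.ofReal r ^ N := by
  calc _ ≤ (Measure.pi fun _ : Fin N => complexNormal)
        (Set.univ.pi fun _ => {z : ℂ | ‖z‖ ^ 2 < r}) := by
        refine measure_mono fun h hh i _ => ?_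
        exact (Finset.single_le_sum (f := fun i => ‖h i‖ ^ 2) (fun _ _ => sq_nonneg _)
          (Finset.mem_univ i)).trans_lt hh
    _ ≤ ENNReal.ofReal r ^ N := by
        rw [Measure.pi_pi]
        simp only [complexNormal_normSq_lt, Finset.prod_const, Finset.card_univ, Fintype.card_fin]
        gcongr
        have := Real.add_one_le_exp (-r)
        linarith

/-- Anti-concentration of a unit linear form in the channel coefficients: some weight has squared
modulus at least `1 / N`, and the density of the matching coefficient is at most `1 / π`. -/
theorem pi_complexNormal_dotProduct_lt_le {N : ℕ} {w : Fin N → ℂ} (hw : ∑ i, ‖w i‖ ^ 2 = 1)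
    {u : ℝ} (hu : 0 ≤ u) :
    (Measure.pi fun _ : Fin N => complexNormal) {h | ‖h ⬝ᵥ w‖ ^ 2 < u} ≤
      ENNReal.ofReal (N * u) := by
  obtain _ | n := N
  · simp at hw
  obtain ⟨i, hi⟩ : ∃ i, 1 ≤ ((n + 1 : ℕ) : ℝ) * ‖w i‖ ^ 2 := by
    by_contra! hlt
    have h := Finset.sum_lt_sum_of_nonempty (Finset.univ_nonempty (α := Fin (n + 1)))
      fun i _ => hlt i
    rw [← Finset.mul_sum, hw] at h
    simp at h
  have hwi : 0 < ‖w i‖ ^ 2 := by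
    by_contra! hle
    have : ((n + 1 : ℕ) : ℝ) * ‖w i‖ ^ 2 ≤ 0 := mul_nonpos_of_nonneg_of_nonpos (by positivity) hle
    linarith
  have hwi' : 0 < ‖w i‖ := by
    by_contra! hle
    simp [le_antisymm hle (norm_nonneg _)] at hwi
  let T : Set (ℂ × (Fin n → ℂ)) :=
    {p | ‖p.1 * w i + ∑ j, p.2 j * w (i.succAbove j)‖ ^ 2 < u}
  have hT : MeasurableSet T := measurableSet_lt (by fun_prop) measurable_const
  have hmp := measurePreserving_piFinSuccAbove (fun _ : Fin (n + 1) => complexNormal) i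
  have hpre : {h : Fin (n + 1) → ℂ | ‖h ⬝ᵥ w‖ ^ 2 < u} =
      MeasurableEquiv.piFinSuccAbove (fun _ => ℂ) i ⁻¹' T := by
    ext h
    simp only [dotProduct, Fin.sum_univ_succAbove _ i]
    rfl
  rw [hpre, hmp.measure_preimage hT.nullMeasurableSet, Measure.prod_apply_symm hT]
  calc _ ≤ ∫⁻ _, ENNReal.ofReal ((n + 1 : ℕ) * u) ∂(Measure.pi fun _ : Fin n => complexNormal) := by
        refine lintegral_mono fun y => ?_
        set c := ∑ j, y j * w (i.succAbove j)
        calc _ ≤ complexNormal (Metric.ball (-c / w i) (√u / ‖w i‖)) := by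
              refine measure_mono fun z hz => ?_
              have hz : ‖z * w i + c‖ ^ 2 < u := hz
              have hz' : ‖z * w i + c‖ < √u := Real.lt_sqrt_of_sq_lt hz
              have h0 : w i ≠ 0 := norm_pos_iff.1 hwi'
              rw [Metric.mem_ball, dist_eq_norm, lt_div_iff₀ hwi', ← norm_mul]
              rwa [sub_mul, div_mul_cancel₀ _ h0, sub_neg_eq_add]
          _ ≤ ENNReal.ofReal ((√u / ‖w i‖) ^ 2) := complexNormal_ball_le _ (by positivity)
          _ ≤ _ := by
              refine ENNReal.ofReal_le_ofReal ?_
              rw [div_pow, Real.sq_sqrt hu, div_le_iff₀ hwi]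
              nlinarith
    _ = _ := by simp

/-! ### The leading term -/

theorem abs_one_sub_exp_neg_div_le {δ y : ℝ} (hδ : 0 < δ) (hy : 0 ≤ y) :
    |(1 - Real.exp (-(δ * y))) / δ| ≤ y := by
  have h1 : Real.exp (-(δ * y)) ≤ 1 := Real.exp_le_one_iff.2 (by nlinarith)
  have h2 := Real.add_one_le_exp (-(δ * y))
  rw [abs_of_nonneg (div_nonneg (by linarith) hδ.le), div_le_iff₀ hδ]
  linarith

theorem tendsto_one_sub_exp_neg_div (y : ℝ) :
    Tendsto (fun δ : ℝ => (1 - Real.exp (-(δ * y))) / δ) (𝓝[>] 0) (𝓝 y) := by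
  have h : HasDerivAt (fun δ : ℝ => 1 - Real.exp (-(δ * y))) y 0 := by
    have := (((hasDerivAt_id (0 : ℝ)).mul_const y).neg.exp).const_sub 1
    simpa using this
  have := h.tendsto_slope_zero_right
  refine this.congr fun δ => ?_
  simp [div_eq_inv_mul]

/-- The dominated convergence step for the leading term, after rescaling the gain of the direct
link by the square root of the normalised threshold. -/
theorem tendsto_integral_leading (m : ℕ) {c : ℝ} (hc : 0 ≤ c) :
    Tendsto (fun δ : ℝ => ∫ s in (0 : ℝ)..1, s ^ (m + 1) * Real.exp (-(δ * s)) *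
        ((1 - Real.exp (-(δ * (c * (1 - s ^ 2) / s)))) / δ))
      (𝓝[>] 0) (𝓝 (2 * c / ((m + 1) * (m + 3)))) := by
  have hlim : ∫ s in (0 : ℝ)..1, s ^ (m + 1) * 1 * (c * (1 - s ^ 2) / s) =
      2 * c / ((m + 1) * (m + 3)) := by
    have : ∀ s ∈ Set.uIoc (0 : ℝ) 1, s ^ (m + 1) * 1 * (c * (1 - s ^ 2) / s) =
        c * (s ^ m - s ^ (m + 2)) := by
      intro s hs
      rw [Set.uIoc_of_le zero_le_one] at hs
      have := hs.1.ne'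
      field_simp
      ring
    rw [intervalIntegral.integral_congr_ae (ae_of_all _ this), intervalIntegral.integral_const_mul,
      intervalIntegral.integral_sub (by simp) (by simp), integral_pow, integral_pow]
    push_cast
    simp only [one_pow, ne_eq, Nat.add_eq_zero_iff, one_ne_zero, OfNat.ofNat_ne_zero, and_false,
      not_false_eq_true, zero_pow, sub_zero]
    have h1 : (m : ℝ) + 1 ≠ 0 := by positivity
    have h3 : (m : ℝ) + 2 + 1 ≠ 0 := by positivity
    have h4 : (m : ℝ) + 3 ≠ 0 := by positivity
    field_simp
    ring
  rw [← hlim]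
  refine intervalIntegral.tendsto_integral_filter_of_dominated_convergence (fun _ => c) ?_ ?_
    (by simp) ?_
  · exact Eventually.of_forall fun δ => Measurable.aestronglyMeasurable (by fun_prop)
  · filter_upwards [self_mem_nhdsWithin] with δ hδ
    have hδ : 0 < δ := hδ
    refine ae_of_all _ fun s hs => ?_
    rw [Set.uIoc_of_le zero_le_one] at hs
    obtain ⟨hs0, hs1⟩ := hs
    have hy : 0 ≤ c * (1 - s ^ 2) / s := div_nonneg (mul_nonneg hc (by nlinarith)) hs0.le
    rw [norm_mul, Real.norm_eq_abs, Real.norm_eq_abs, abs_of_nonneg (by positivity)]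
    calc s ^ (m + 1) * Real.exp (-(δ * s)) * _ ≤ s * 1 * (c * (1 - s ^ 2) / s) := by
          refine mul_le_mul (mul_le_mul ?_ ?_ (Real.exp_pos _).le hs0.le)
            (abs_one_sub_exp_neg_div_le hδ hy) (abs_nonneg _) (by positivity)
          · exact pow_le_of_le_one hs0.le hs1 (by omega)
          · exact Real.exp_le_one_iff.2 (by nlinarith)
      _ = c * (1 - s ^ 2) := by field_simp
      _ ≤ c := mul_le_of_le_one_right hc (by nlinarith)
  · refine ae_of_all _ fun s _ => ?_
    refine Tendsto.mul (tendsto_const_nhds.mul ?_) (tendsto_one_sub_exp_neg_div _)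
    have : Tendsto (fun δ : ℝ => Real.exp (-(δ * s))) (𝓝 0) (𝓝 (Real.exp (-(0 * s)))) :=
      (Continuous.tendsto (by fun_prop) 0)
    simpa using this.mono_left nhdsWithin_le_nhds

/-- The joint law of the channels `(h₁, h₂, h₃)` under Rayleigh fading. -/
noncomputable def channelLaw (N : ℕ) : Measure ((Fin N → ℂ) × (Fin N → ℂ) × ℂ) :=
  (Measure.pi fun _ : Fin N => complexNormal).prod
    ((Measure.pi fun _ : Fin N => complexNormal).prod complexNormal)

instance (N : ℕ) : IsProbabilityMeasure (channelLaw N) := by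
  unfold channelLaw
  infer_instance

/-- The channels for which `‖h₁‖² < δ` and `‖h₁‖² |h₃|² < c (δ² - ‖h₁‖⁴)`. For `c = 1 / a` this is
the outage event `‖h₁‖⁴ + a ‖h₁‖² |h₃|² < δ²` of a system whose relay-to-access-point hop is ideal,
where `a` is the SNR scale of the user-to-relay link relative to the direct link. -/
def leadingEvent (N : ℕ) (c δ : ℝ) : Set ((Fin N → ℂ) × (Fin N → ℂ) × ℂ) :=
  {p | ∑ i, ‖p.1 i‖ ^ 2 < δ ∧
    (∑ i, ‖p.1 i‖ ^ 2) * ‖p.2.2‖ ^ 2 < c * (δ ^ 2 - (∑ i, ‖p.1 i‖ ^ 2) ^ 2)}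

theorem measurableSet_leadingEvent (N : ℕ) (c δ : ℝ) : MeasurableSet (leadingEvent N c δ) := by
  rw [leadingEvent, Set.ofPred_and]
  exact (measurableSet_lt (by fun_prop) measurable_const).inter
    (measurableSet_lt (by fun_prop) (by fun_prop))

/-- Conditioning on the gain `x = ‖h₁‖²`, of law `Gamma(n + 1)`, leaves an exponential tail in
`|h₃|²`. -/
theorem channelLaw_leadingEvent (n : ℕ) (c δ : ℝ) :
    channelLaw (n + 1) (leadingEvent (n + 1) c δ) =
      ∫⁻ x in Set.Ioo 0 δ, ENNReal.ofReal (x ^ n / n.factorial * Real.exp (-x) *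
        (1 - Real.exp (-(c * (δ ^ 2 - x ^ 2) / x)))) := by
  let V : Set (ℝ × ℂ) := {q | q.1 < δ ∧ q.1 * ‖q.2‖ ^ 2 < c * (δ ^ 2 - q.1 ^ 2)}
  have hV : MeasurableSet V := by
    simp only [V, Set.ofPred_and]
    exact (measurableSet_lt (by fun_prop) measurable_const).inter
      (measurableSet_lt (by fun_prop) (by fun_prop))
  have hsec : ∀ h : Fin (n + 1) → ℂ, ((Measure.pi fun _ : Fin (n + 1) => complexNormal).prod
      complexNormal) (Prod.mk h ⁻¹' leadingEvent (n + 1) c δ) =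
        complexNormal (Prod.mk (∑ i, ‖h i‖ ^ 2) ⁻¹' V) := by
    intro h
    have : Prod.mk h ⁻¹' leadingEvent (n + 1) c δ =
        Set.univ ×ˢ (Prod.mk (∑ i, ‖h i‖ ^ 2) ⁻¹' V) := by
      ext q
      simp [leadingEvent, V]
    rw [this, Measure.prod_prod, measure_univ, one_mul]
  rw [channelLaw, Measure.prod_apply (measurableSet_leadingEvent _ _ _)]
  simp_rw [hsec]
  rw [lintegral_sum_normSq n (f := fun x => complexNormal (Prod.mk x ⁻¹' V))
    (measurable_measure_prodMk_left hV), ← Set.Iio_inter_Ioi,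
    ← Measure.restrict_restrict measurableSet_Iio, ← lintegral_indicator measurableSet_Iio]
  refine setLIntegral_congr_fun measurableSet_Ioi fun x hx => ?_
  have hx : 0 < x := hx
  by_cases hxδ : x < δ
  · have : Prod.mk x ⁻¹' V = {z : ℂ | ‖z‖ ^ 2 < c * (δ ^ 2 - x ^ 2) / x} := by
      ext z
      simp only [V, Set.mem_preimage, Set.mem_ofPred_eq, hxδ, true_and, lt_div_iff₀ hx]
      rw [mul_comm]
    rw [Set.indicator_of_mem (Set.mem_Iio.2 hxδ)]
    simp only [this, complexNormal_normSq_lt]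
    rw [← ENNReal.ofReal_mul (by positivity)]
  · have : Prod.mk x ⁻¹' V = ∅ := by
      ext z
      simp [V, hxδ]
    rw [Set.indicator_of_notMem (by simpa using hxδ)]
    simp [this]

theorem channelLaw_real_leadingEvent (n : ℕ) {c δ : ℝ} (hc : 0 ≤ c) (hδ : 0 < δ) :
    (channelLaw (n + 1)).real (leadingEvent (n + 1) c δ) =
      δ ^ (n + 2) / n.factorial * ∫ s in (0 : ℝ)..1, s ^ n * Real.exp (-(δ * s)) *
        ((1 - Real.exp (-(δ * (c * (1 - s ^ 2) / s)))) / δ) := by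
  have hnn : ∀ x ∈ Set.Ioo 0 δ, 0 ≤ 1 - Real.exp (-(c * (δ ^ 2 - x ^ 2) / x)) := by
    intro x hx
    have : 0 ≤ c * (δ ^ 2 - x ^ 2) / x :=
      div_nonneg (mul_nonneg hc (by nlinarith [hx.1, hx.2])) hx.1.le
    have := Real.exp_le_one_iff.2 (neg_nonpos.2 this)
    linarith
  have hint : IntegrableOn (fun x => x ^ n / n.factorial * Real.exp (-x) *
      (1 - Real.exp (-(c * (δ ^ 2 - x ^ 2) / x)))) (Set.Ioo 0 δ) := by
    refine Measure.integrableOn_of_bounded (M := δ ^ n / n.factorial) (by simp)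
      (Measurable.aestronglyMeasurable (by fun_prop))
      ((ae_restrict_mem measurableSet_Ioo).mono fun x hx => ?_)
    have h1 := hnn x hx
    have h2 := hx.1.le
    have h3 := hx.2.le
    rw [Real.norm_of_nonneg (by positivity), mul_assoc]
    refine (mul_le_of_le_one_right (by positivity) ?_).trans (by gcongr)
    refine mul_le_one₀ (Real.exp_le_one_iff.2 (by linarith)) h1 ?_
    have := Real.exp_pos (-(c * (δ ^ 2 - x ^ 2) / x))
    linarith
  rw [Measure.real, channelLaw_leadingEvent, ← ofReal_integral_eq_lintegral_ofReal hint
    ((ae_restrict_mem measurableSet_Ioo).mono fun x hx => mul_nonneg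
      (by have := hx.1.le; positivity) (hnn x hx)), ENNReal.toReal_ofReal
    (setIntegral_nonneg measurableSet_Ioo fun x hx => mul_nonneg
      (by have := hx.1.le; positivity) (hnn x hx)), ← integral_Ioc_eq_integral_Ioo,
    ← intervalIntegral.integral_of_le hδ.le]
  have hscale := intervalIntegral.mul_integral_comp_mul_left (a := 0) (b := 1) (c := δ)
    (f := fun x => x ^ n / n.factorial * Real.exp (-x) *
      (1 - Real.exp (-(c * (δ ^ 2 - x ^ 2) / x))))
  rw [mul_zero, mul_one] at hscale
  rw [← hscale, ← intervalIntegral.integral_const_mul, ← intervalIntegral.integral_const_mul]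
  refine intervalIntegral.integral_congr_ae (ae_of_all _ fun s hs => ?_)
  rw [Set.uIoc_of_le zero_le_one] at hs
  have hs0 := hs.1.ne'
  have : c * (δ ^ 2 - (δ * s) ^ 2) / (δ * s) = δ * (c * (1 - s ^ 2) / s) := by
    field_simp
  rw [this]
  field_simp
  ring

theorem tendsto_channelLaw_leadingEvent (m : ℕ) {c : ℝ} (hc : 0 ≤ c) :
    Tendsto (fun δ : ℝ => (channelLaw (m + 2)).real (leadingEvent (m + 2) c δ) / δ ^ (m + 3))
      (𝓝[>] 0) (𝓝 (2 * c / ((m + 1).factorial * (m + 1) * (m + 3)))) := by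
  have h := (tendsto_integral_leading m hc).const_mul ((m + 1).factorial : ℝ)⁻¹
  have hval : ((m + 1).factorial : ℝ)⁻¹ * (2 * c / ((m + 1) * (m + 3))) =
      2 * c / ((m + 1).factorial * (m + 1) * (m + 3)) := by
    field_simp
  rw [hval] at h
  refine h.congr' ?_
  filter_upwards [self_mem_nhdsWithin] with δ hδ
  have hδ : 0 < δ := hδ
  rw [channelLaw_real_leadingEvent (m + 1) hc hδ]
  field_simp

/-! ### Maximum ratio transmission -/

theorem vecNorm_sq {N : ℕ} (h : Fin N → ℂ) : vecNorm h ^ 2 = ∑ i, ‖h i‖ ^ 2 :=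
  Real.sq_sqrt (Finset.sum_nonneg fun _ _ => sq_nonneg _)

theorem norm_dotProduct_mrt_sq {N : ℕ} (h : Fin N → ℂ) :
    ‖h ⬝ᵥ mrt h‖ ^ 2 = ∑ i, ‖h i‖ ^ 2 := by
  have hdot : h ⬝ᵥ mrt h = ((vecNorm h ^ 2 / vecNorm h : ℝ) : ℂ) := by
    rw [vecNorm_sq]
    simp only [dotProduct, mrt, mul_div_assoc', ← Finset.sum_div]
    push_cast
    congr 1
    refine Finset.sum_congr rfl fun i _ => ?_
    exact Complex.mul_conj' (h i)
  rw [hdot, Complex.norm_real, ← vecNorm_sq, Real.norm_eq_abs, sq_abs, sq (vecNorm h),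
    mul_self_div_self, sq]

theorem sum_norm_mrt_sq {N : ℕ} {h : Fin N → ℂ} (hh : ∑ i, ‖h i‖ ^ 2 ≠ 0) :
    ∑ i, ‖mrt h i‖ ^ 2 = 1 := by
  simp only [mrt, norm_div, norm_star, Complex.norm_real, Real.norm_eq_abs, div_pow, sq_abs,
    vecNorm_sq]
  rw [← Finset.sum_div, div_self hh]

theorem measurable_mrt (N : ℕ) : Measurable (mrt : (Fin N → ℂ) → Fin N → ℂ) := by
  unfold mrt vecNorm
  fun_prop

theorem measurable_dotProduct_mrt (N : ℕ) :
    Measurable fun p : (Fin N → ℂ) × (Fin N → ℂ) × ℂ => p.2.1 ⬝ᵥ mrt p.1 := by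
  have := measurable_mrt N
  unfold dotProduct
  fun_prop

theorem ae_sum_normSq_ne_zero (n : ℕ) :
    ∀ᵐ h ∂(Measure.pi fun _ : Fin (n + 1) => complexNormal), ∑ i, ‖h i‖ ^ 2 ≠ 0 := by
  have hm : Measurable (({0} : Set ℝ).indicator (1 : ℝ → ℝ≥0∞)) :=
    measurable_one.indicator (measurableSet_singleton 0)
  have h := lintegral_sum_normSq n hm
  have h0 : ∫⁻ x in Set.Ioi (0 : ℝ), ENNReal.ofReal (x ^ n / n.factorial * Real.exp (-x)) *
      ({0} : Set ℝ).indicator 1 x = 0 := by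
    rw [← lintegral_zero (μ := volume.restrict (Set.Ioi (0 : ℝ)))]
    refine setLIntegral_congr_fun measurableSet_Ioi fun x hx => ?_
    have : x ≠ 0 := ne_of_gt hx
    simp [this]
  rw [h0, lintegral_eq_zero_iff (by fun_prop)] at h
  filter_upwards [h] with x hx hx0
  simp [hx0] at hx

/-! ### The contribution of weak relay channels -/

/-- The channels for which `‖h₁‖² < δ` and the gain of the relay-to-access-point link is less than
`K δ²`. -/
def weakRelayEvent (N : ℕ) (K δ : ℝ) : Set ((Fin N → ℂ) × (Fin N → ℂ) × ℂ) :=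
  {p | ∑ i, ‖p.1 i‖ ^ 2 < δ ∧ ‖p.2.1 ⬝ᵥ mrt p.1‖ ^ 2 * ∑ i, ‖p.2.1 i‖ ^ 2 < K * δ ^ 2}

theorem measurableSet_weakRelayEvent (N : ℕ) (K δ : ℝ) :
    MeasurableSet (weakRelayEvent N K δ) := by
  have := measurable_dotProduct_mrt N
  rw [weakRelayEvent, Set.ofPred_and]
  exact (measurableSet_lt (by fun_prop) measurable_const).inter
    (measurableSet_lt (by fun_prop) measurable_const)

/-- If the product of the two factors of the relay gain is below `K θ⁶`, then one of them is below
`K θ⁴` or the other is below `θ²`; both alternatives have conditional probability `O(θ⁴)` given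
`h₁`, as soon as there are two antennas. -/
theorem channelLaw_weakRelayEvent_le (m : ℕ) {K θ : ℝ} (hK : 0 ≤ K) (hθ : 0 < θ) (hθ1 : θ ≤ 1) :
    channelLaw (m + 2) (weakRelayEvent (m + 2) K (θ ^ 3)) ≤
      ENNReal.ofReal (((m + 2 : ℕ) * K + 1) * θ ^ 4 * (θ ^ 3) ^ (m + 2)) := by
  set μ := Measure.pi fun _ : Fin (m + 2) => complexNormal with hμ
  set C := ENNReal.ofReal (((m + 2 : ℕ) * K + 1) * θ ^ 4) with hC
  have hB : MeasurableSet {h : Fin (m + 2) → ℂ | ∑ i, ‖h i‖ ^ 2 < θ ^ 3} :=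
    measurableSet_lt (by fun_prop) measurable_const
  rw [channelLaw, Measure.prod_apply (measurableSet_weakRelayEvent _ _ _)]
  calc _ ≤ ∫⁻ h, {h : Fin (m + 2) → ℂ | ∑ i, ‖h i‖ ^ 2 < θ ^ 3}.indicator (fun _ => C) h ∂μ := by
        refine lintegral_mono_ae ?_
        filter_upwards [ae_sum_normSq_ne_zero (m + 1)] with h hh
        by_cases hlt : ∑ i, ‖h i‖ ^ 2 < θ ^ 3
        · rw [Set.indicator_of_mem (by exact hlt)]
          have hsub : Prod.mk h ⁻¹' weakRelayEvent (m + 2) K (θ ^ 3) ⊆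
              ({g | ‖g ⬝ᵥ mrt h‖ ^ 2 < K * θ ^ 4} ∪ {g | ∑ i, ‖g i‖ ^ 2 < θ ^ 2}) ×ˢ
                (Set.univ : Set ℂ) := by
            rintro ⟨g, z⟩ hg
            refine ⟨?_, trivial⟩
            have hg' : ‖g ⬝ᵥ mrt h‖ ^ 2 * ∑ i, ‖g i‖ ^ 2 < K * (θ ^ 3) ^ 2 := hg.2
            by_contra hnot
            simp only [Set.mem_union, Set.mem_ofPred_eq, not_or, not_lt] at hnot
            have := mul_le_mul hnot.1 hnot.2 (by positivity) (by positivity)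
            have e : K * θ ^ 4 * θ ^ 2 = K * (θ ^ 3) ^ 2 := by ring
            linarith
          refine (measure_mono hsub).trans ?_
          rw [Measure.prod_prod, measure_univ, mul_one]
          refine (measure_union_le _ _).trans ?_
          refine (add_le_add (pi_complexNormal_dotProduct_lt_le (sum_norm_mrt_sq hh)
            (u := K * θ ^ 4) (by positivity)) (pi_complexNormal_sum_normSq_lt_le _ _)).trans ?_
          rw [← ENNReal.ofReal_pow (by positivity), ← ENNReal.ofReal_add (by positivity)
            (by positivity)]
          refine ENNReal.ofReal_le_ofReal ?_
          have : (θ ^ 2) ^ (m + 2) ≤ θ ^ 4 := by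
            rw [← pow_mul]
            exact pow_le_pow_of_le_one hθ.le hθ1 (by omega)
          linarith
        · have : Prod.mk h ⁻¹' weakRelayEvent (m + 2) K (θ ^ 3) = ∅ := by
            ext q
            simp [weakRelayEvent, hlt]
          simp [this]
    _ ≤ C * ENNReal.ofReal (θ ^ 3) ^ (m + 2) := by
        rw [lintegral_indicator_const hB]
        gcongr
        exact pi_complexNormal_sum_normSq_lt_le _ _
    _ = _ := by
        rw [hC, ← ENNReal.ofReal_pow (by positivity), ← ENNReal.ofReal_mul (by positivity)]

theorem tendsto_channelLaw_weakRelayEvent (m : ℕ) {K : ℝ} (hK : 0 ≤ K) :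
    Tendsto (fun δ : ℝ => (channelLaw (m + 2)).real (weakRelayEvent (m + 2) K δ) / δ ^ (m + 3))
      (𝓝[>] 0) (𝓝 0) := by
  have hlim : Tendsto (fun δ : ℝ => ((m + 2 : ℕ) * K + 1) * δ ^ (1 / 3 : ℝ)) (𝓝[>] 0) (𝓝 0) := by
    have h : Tendsto (fun δ : ℝ => δ ^ (1 / 3 : ℝ)) (𝓝 0) (𝓝 (0 ^ (1 / 3 : ℝ))) :=
      (Real.continuousAt_rpow_const 0 (1 / 3) (Or.inr (by norm_num))).tendsto
    rw [Real.zero_rpow (by norm_num)] at h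
    simpa using (h.mono_left nhdsWithin_le_nhds).const_mul (((m + 2 : ℕ) : ℝ) * K + 1)
  refine squeeze_zero' ?_ ?_ hlim
  · filter_upwards [self_mem_nhdsWithin] with δ hδ
    have hδ : 0 < δ := hδ
    positivity
  · filter_upwards [self_mem_nhdsWithin, nhdsWithin_le_nhds (Iio_mem_nhds one_pos)] with δ hδ hδ1
    have hδ : 0 < δ := hδ
    have hδ1 : δ < 1 := hδ1
    set θ := δ ^ (1 / 3 : ℝ) with hθdef
    have hθ : 0 < θ := Real.rpow_pos_of_pos hδ _
    have hθ1 : θ ≤ 1 := Real.rpow_le_one hδ.le hδ1.le (by norm_num)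
    have hcube : θ ^ 3 = δ := by
      rw [hθdef, ← Real.rpow_natCast, ← Real.rpow_mul hδ.le]
      norm_num
    rw [← hcube, div_le_iff₀ (by positivity), Measure.real]
    refine (ENNReal.toReal_le_of_le_ofReal (by positivity)
      (channelLaw_weakRelayEvent_le m hK hθ hθ1)).trans_eq ?_
    ring

/-! ### Asymptotics of the outage event -/

/-- The outage event under maximum ratio transmission, in the normalised parameters: `γ` is the
threshold, `γ / δ²` is the average SNR scale of the direct link, and `a` and `b` are the average
SNR scales of the user-to-relay and relay-to-access-point links relative to it. -/
def outageEvent (N : ℕ) (a b γ δ : ℝ) : Set ((Fin N → ℂ) × (Fin N → ℂ) × ℂ) :=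
  {p | γ / δ ^ 2 * (∑ i, ‖p.1 i‖ ^ 2) ^ 2 +
    (γ / δ ^ 2 * (a * ((∑ i, ‖p.1 i‖ ^ 2) * ‖p.2.2‖ ^ 2))) *
      (γ / δ ^ 2 * (b * (‖p.2.1 ⬝ᵥ mrt p.1‖ ^ 2 * ∑ i, ‖p.2.1 i‖ ^ 2))) /
      (γ / δ ^ 2 * (a * ((∑ i, ‖p.1 i‖ ^ 2) * ‖p.2.2‖ ^ 2)) +
        γ / δ ^ 2 * (b * (‖p.2.1 ⬝ᵥ mrt p.1‖ ^ 2 * ∑ i, ‖p.2.1 i‖ ^ 2)) + 1) < γ}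

theorem measurableSet_outageEvent (N : ℕ) (a b γ δ : ℝ) :
    MeasurableSet (outageEvent N a b γ δ) := by
  have := measurable_dotProduct_mrt N
  exact measurableSet_lt (by fun_prop) measurable_const

/-- The relay link is never better than its first hop. -/
theorem combined_lt_of_add_lt {k D A B γ : ℝ} (hk : 0 ≤ k) (hA : 0 ≤ A) (hB : 0 ≤ B)
    (h : k * D + k * A < γ) :
    k * D + (k * A) * (k * B) / (k * A + k * B + 1) < γ := by
  have hkA := mul_nonneg hk hA
  have hkB := mul_nonneg hk hB
  have : (k * A) * (k * B) / (k * A + k * B + 1) ≤ k * A := by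
    rw [div_le_iff₀ (by positivity)]
    nlinarith
  linarith

/-- If the gain `B` of the second hop is at least `M` times the normalised threshold `ε`, then an
outage forces the outage condition `A < ε - D` of an ideal second hop, up to a factor that tends to
`1` as `M → ∞`. -/
theorem lt_of_combined_lt {D A B γ ε M : ℝ} (hγ : 0 < γ) (hε : 0 < ε) (hM : 1 < M) (hD : 0 ≤ D)
    (hA : 0 ≤ A) (hB : M * ε ≤ B)
    (h : γ / ε * D + (γ / ε * A) * (γ / ε * B) / (γ / ε * A + γ / ε * B + 1) < γ) :
    D < ε ∧ A < (M + γ⁻¹) / (M - 1) * (ε - D) := by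
  have hB0 : 0 < B := by nlinarith
  have hk : 0 < γ / ε := div_pos hγ hε
  have hden : 0 < γ / ε * A + γ / ε * B + 1 := by positivity
  have hDε : D < ε := by
    have h0 : 0 ≤ (γ / ε * A) * (γ / ε * B) / (γ / ε * A + γ / ε * B + 1) := by positivity
    have h1 : γ / ε * D < γ := by linarith
    rw [div_mul_eq_mul_div, div_lt_iff₀ hε] at h1
    exact lt_of_mul_lt_mul_left h1 hγ.le
  refine ⟨hDε, ?_⟩
  set t := ε - D with ht
  have ht0 : 0 < t := by linarith
  have h2 : (γ / ε * A) * (γ / ε * B) / (γ / ε * A + γ / ε * B + 1) < γ / ε * t := by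
    have : γ / ε * t = γ - γ / ε * D := by rw [ht]; field_simp
    linarith
  have h3 : A * (B - t) < t * (B + γ⁻¹ * ε) := by
    rw [div_lt_iff₀ hden] at h2
    have e1 : (γ / ε * A) * (γ / ε * B) = (γ / ε) ^ 2 * (A * B) := by ring
    have e2 : γ / ε * t * (γ / ε * A + γ / ε * B + 1) =
        (γ / ε) ^ 2 * (t * (A + B + γ⁻¹ * ε)) := by field_simp
    rw [e1, e2] at h2
    have := lt_of_mul_lt_mul_left h2 (by positivity)
    linarith
  have hγi : 0 < γ⁻¹ := inv_pos.2 hγ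
  have hpos : 0 < B + γ⁻¹ * ε := by positivity
  have h4 : (M - 1) * (B + γ⁻¹ * ε) ≤ (B - t) * (M + γ⁻¹) := by
    have h5 : (B - ε) * (M + γ⁻¹) ≤ (B - t) * (M + γ⁻¹) :=
      mul_le_mul_of_nonneg_right (by linarith) (by linarith)
    have h6 : 0 ≤ (γ⁻¹ + 1) * (B - M * ε) := mul_nonneg (by linarith) (by linarith)
    linarith
  rw [div_mul_eq_mul_div, lt_div_iff₀ (by linarith)]
  have h7 : A * (M - 1) * (B + γ⁻¹ * ε) < (M + γ⁻¹) * t * (B + γ⁻¹ * ε) := by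
    have h8 := mul_le_mul_of_nonneg_left h4 hA
    have h9 := mul_lt_mul_of_pos_right h3 (show 0 < M + γ⁻¹ by linarith)
    linarith
  exact lt_of_mul_lt_mul_right h7 hpos.le

theorem leadingEvent_subset_outageEvent (N : ℕ) {a b γ δ : ℝ} (ha : 0 < a) (hb : 0 < b)
    (hγ : 0 < γ) (hδ : 0 < δ) : leadingEvent N a⁻¹ δ ⊆ outageEvent N a b γ δ := by
  rintro p ⟨-, h2⟩
  refine combined_lt_of_add_lt (by positivity) (by positivity) (by positivity) ?_
  rw [inv_mul_eq_div, lt_div_iff₀ ha] at h2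
  rw [← mul_add, div_mul_eq_mul_div, div_lt_iff₀ (by positivity)]
  refine mul_lt_mul_of_pos_left ?_ hγ
  linarith

theorem outageEvent_subset (N : ℕ) {a b γ δ M : ℝ} (ha : 0 < a) (hb : 0 < b) (hγ : 0 < γ)
    (hδ : 0 < δ) (hM : 1 < M) :
    outageEvent N a b γ δ ⊆
      leadingEvent N ((M + γ⁻¹) / (M - 1) * a⁻¹) δ ∪ weakRelayEvent N (M / b) δ := by
  intro p hp
  have hX : 0 ≤ ∑ i, ‖p.1 i‖ ^ 2 := by positivity
  -- the relay link contributes nonnegatively, so the direct link alone is in outage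
  have hlt : ∑ i, ‖p.1 i‖ ^ 2 < δ := by
    have h0 : γ / δ ^ 2 * (∑ i, ‖p.1 i‖ ^ 2) ^ 2 < γ :=
      lt_of_le_of_lt (le_add_of_nonneg_right (by positivity)) hp
    rw [div_mul_eq_mul_div, div_lt_iff₀ (by positivity)] at h0
    exact lt_of_pow_lt_pow_left₀ 2 hδ.le (lt_of_mul_lt_mul_left h0 hγ.le)
  by_cases hB : M * δ ^ 2 ≤ b * (‖p.2.1 ⬝ᵥ mrt p.1‖ ^ 2 * ∑ i, ‖p.2.1 i‖ ^ 2)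
  · left
    refine ⟨hlt, ?_⟩
    have h := (lt_of_combined_lt hγ (by positivity) hM (by positivity) (by positivity) hB hp).2
    rw [mul_assoc, mul_comm a⁻¹, ← mul_assoc, ← div_eq_mul_inv, lt_div_iff₀ ha]
    linarith
  · right
    refine ⟨hlt, ?_⟩
    rw [div_mul_eq_mul_div, lt_div_iff₀ hb]
    linarith

theorem tendsto_channelLaw_outageEvent (m : ℕ) {a b γ : ℝ} (ha : 0 < a) (hb : 0 < b)
    (hγ : 0 < γ) :
    Tendsto (fun δ : ℝ => (channelLaw (m + 2)).real (outageEvent (m + 2) a b γ δ) / δ ^ (m + 3))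
      (𝓝[>] 0) (𝓝 (2 * a⁻¹ / ((m + 1).factorial * (m + 1) * (m + 3)))) := by
  refine tendsto_order.2 ⟨fun l hl => ?_, fun u hu => ?_⟩
  · filter_upwards [(tendsto_channelLaw_leadingEvent m (inv_pos.2 ha).le).eventually_const_lt hl,
      self_mem_nhdsWithin] with δ h hδ
    have hδ : 0 < δ := hδ
    refine h.trans_le ?_
    have := measureReal_mono (μ := channelLaw (m + 2))
      (leadingEvent_subset_outageEvent (m + 2) ha hb hγ hδ)
    gcongr
  · -- the loss factor `(M + γ⁻¹) / (M - 1)` tends to `1` as `M` grows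
    have hfac : Tendsto (fun M : ℝ => (M + γ⁻¹) / (M - 1)) atTop (𝓝 1) := by
      have h1 : Tendsto (fun M : ℝ => 1 + (1 + γ⁻¹) / (M - 1)) atTop (𝓝 (1 + 0)) :=
        tendsto_const_nhds.add (tendsto_const_nhds.div_atTop
          (tendsto_atTop_add_const_right _ (-1) tendsto_id))
      rw [add_zero] at h1
      refine h1.congr' ?_
      filter_upwards [eventually_gt_atTop 1] with M hM
      have : M - 1 ≠ 0 := by linarith
      field_simp
      ring
    have hconst : Tendsto (fun M : ℝ => 2 * ((M + γ⁻¹) / (M - 1) * a⁻¹) /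
        ((m + 1).factorial * (m + 1) * (m + 3))) atTop
        (𝓝 (2 * (1 * a⁻¹) / ((m + 1).factorial * (m + 1) * (m + 3)))) :=
      ((hfac.mul_const _).const_mul 2).div_const _
    rw [one_mul] at hconst
    obtain ⟨M, hMu, hM⟩ := ((hconst.eventually_lt_const hu).and (eventually_gt_atTop 1)).exists
    have hc : 0 ≤ (M + γ⁻¹) / (M - 1) * a⁻¹ :=
      mul_nonneg (div_nonneg (by positivity) (by linarith)) (by positivity)
    have hsum := (tendsto_channelLaw_leadingEvent m hc).add
      (tendsto_channelLaw_weakRelayEvent m (K := M / b) (by positivity))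
    rw [add_zero] at hsum
    filter_upwards [hsum.eventually_lt_const hMu, self_mem_nhdsWithin] with δ h hδ
    have hδ : 0 < δ := hδ
    refine lt_of_le_of_lt ?_ h
    rw [← add_div]
    gcongr
    exact (measureReal_mono (outageEvent_subset _ ha hb hγ hδ hM)).trans (measureReal_union_le _ _)

/-! ### Diversity order and the outage probability -/

theorem hasDiversityOrder_of_isEquivalent {p : ℝ → ℝ} {C B d : ℝ} (hC : 0 < C) (hB : 0 < B)
    (h : p ~[atTop] fun ρ => C * (B / ρ) ^ d) : HasDiversityOrder p d := by
  have hpos : ∀ᶠ ρ : ℝ in atTop, 0 < C * (B / ρ) ^ d := by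
    filter_upwards [eventually_gt_atTop 0] with ρ hρ
    positivity
  have hratio := (isEquivalent_iff_tendsto_one (hpos.mono fun _ h => h.ne')).1 h
  have hlog : Tendsto (fun ρ => Real.log ((p / fun ρ => C * (B / ρ) ^ d) ρ)) atTop (𝓝 0) := by
    simpa using hratio.log one_ne_zero
  have hmain : Tendsto (fun ρ => d - (Real.log ((p / fun ρ => C * (B / ρ) ^ d) ρ) +
      (Real.log C + d * Real.log B)) / Real.log ρ) atTop (𝓝 (d - 0)) :=
    tendsto_const_nhds.sub ((hlog.add_const _).div_atTop Real.tendsto_log_atTop)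
  rw [sub_zero] at hmain
  refine hmain.congr' ?_
  filter_upwards [eventually_gt_atTop 1, hpos, hratio.eventually_const_lt one_pos] with ρ hρ hq hr
  have hlogρ : Real.log ρ ≠ 0 := (Real.log_pos hρ).ne'
  have hρ0 : 0 < ρ := by linarith
  have hp : p ρ = (p / fun ρ => C * (B / ρ) ^ d) ρ * (C * (B / ρ) ^ d) := by
    simp only [Pi.div_apply]
    rw [div_mul_cancel₀ _ hq.ne']
  have hlp : Real.log (p ρ) = Real.log ((p / fun ρ => C * (B / ρ) ^ d) ρ) +
      (Real.log C + d * (Real.log B - Real.log ρ)) := by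
    conv_lhs => rw [hp]
    rw [Real.log_mul hr.ne' hq.ne', Real.log_mul hC.ne' (by positivity),
      Real.log_rpow (by positivity), Real.log_div hB.ne' hρ0.ne']
  rw [hlp]
  field_simp
  ring

/-- Maximum ratio transmission puts the outage condition into normalised form, with `δ²` equal to
the bracket of the high-SNR expression. -/
theorem Params.setOf_endToEndSNR_mrt_lt (S : Params) (hη : 0 < S.η) (hτ₀ : 0 < S.τ)
    (hτ₁ : S.τ < 1) (hd₁ : 0 < S.d₁) (hd₂ : 0 < S.d₂) (hd₃ : 0 < S.d₃) {γ : ℝ} (hγ : 0 < γ)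
    (N : ℕ) {ρ : ℝ} (hρ : 0 < ρ) :
    {p : (Fin N → ℂ) × (Fin N → ℂ) × ℂ | S.endToEndSNR ρ p.1 p.2.1 p.2.2 (mrt p.1) < γ} =
      outageEvent N (S.d₁ ^ S.α / S.d₃ ^ S.α) ((S.d₁ ^ S.α) ^ 2 / (S.d₂ ^ S.α) ^ 2) γ
        √((1 - S.τ) * S.d₁ ^ (2 * S.α) * γ / (2 * S.η * S.τ) / ρ) := by
  have hτ : 0 < 1 - S.τ := by linarith
  have h1 : 0 < S.d₁ ^ S.α := Real.rpow_pos_of_pos hd₁ _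
  have h2 : 0 < S.d₂ ^ S.α := Real.rpow_pos_of_pos hd₂ _
  have h3 : 0 < S.d₃ ^ S.α := Real.rpow_pos_of_pos hd₃ _
  have hsq : S.d₁ ^ (2 * S.α) = (S.d₁ ^ S.α) ^ 2 := by
    rw [mul_comm, Real.rpow_mul hd₁.le]
    norm_cast
  ext p
  simp only [outageEvent, Set.mem_ofPred_eq, Params.endToEndSNR, Params.directSNR,
    Params.userRelaySNR, Params.relayAPSNR, Params.txSNR, norm_dotProduct_mrt_sq, vecNorm_sq]
  rw [Real.sq_sqrt (by positivity), hsq]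
  set X := ∑ i, ‖p.1 i‖ ^ 2
  set Y := ∑ i, ‖p.2.1 i‖ ^ 2
  set U := ‖p.2.1 ⬝ᵥ mrt p.1‖ ^ 2
  set Z := ‖p.2.2‖ ^ 2
  set D₁ := S.d₁ ^ S.α
  set D₂ := S.d₂ ^ S.α
  set D₃ := S.d₃ ^ S.α
  have e1 : S.η * S.τ * ρ * X / D₁ / ((1 - S.τ) / 2) / D₁ * X =
      γ / ((1 - S.τ) * D₁ ^ 2 * γ / (2 * S.η * S.τ) / ρ) * X ^ 2 := by
    field_simp
  have e2 : S.η * S.τ * ρ * X / D₁ / ((1 - S.τ) / 2) / D₃ * Z =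
      γ / ((1 - S.τ) * D₁ ^ 2 * γ / (2 * S.η * S.τ) / ρ) * (D₁ / D₃ * (X * Z)) := by
    field_simp
  have e3 : S.η * S.τ * ρ * U / D₂ / ((1 - S.τ) / 2) / D₂ * Y =
      γ / ((1 - S.τ) * D₁ ^ 2 * γ / (2 * S.η * S.τ) / ρ) * (D₁ ^ 2 / D₂ ^ 2 * (U * Y)) := by
    field_simp
  rw [e1, e2, e3]

end WirelessPowered

theorem theorem5 {Ω : Type*} [MeasurableSpace Ω] (P : Measure Ω) [IsProbabilityMeasure P]
    (N : ℕ) (hN : 2 ≤ N) (h₁ h₂ : Ω → Fin N → ℂ) (h₃ : Ω → ℂ)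
    (hch : WirelessPowered.IsRayleighChannel P h₁ h₂ h₃)
    (S : WirelessPowered.Params) (hη : 0 < S.η) (hτ₀ : 0 < S.τ) (hτ₁ : S.τ < 1)
    (hd₁ : 0 < S.d₁) (hd₂ : 0 < S.d₂) (hd₃ : 0 < S.d₃) (γth : ℝ) (hγ : 0 < γth) :
    (fun ρ : ℝ => S.outageProb P h₁ h₂ h₃ (fun ω => WirelessPowered.mrt (h₁ ω)) γth ρ)
        ~[atTop] (fun ρ : ℝ => S.outageProbInf N γth ρ) ∧
      WirelessPowered.HasDiversityOrder
        (fun ρ : ℝ => S.outageProb P h₁ h₂ h₃ (fun ω => WirelessPowered.mrt (h₁ ω)) γth ρ)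
        (((N : ℝ) + 1) / 2) := by
  obtain ⟨m, rfl⟩ : ∃ m, N = m + 2 := ⟨N - 2, by omega⟩
  have hτ : 0 < 1 - S.τ := by linarith
  have hD₁ : 0 < S.d₁ ^ S.α := Real.rpow_pos_of_pos hd₁ _
  have hD₂ : 0 < S.d₂ ^ S.α := Real.rpow_pos_of_pos hd₂ _
  have hD₃ : 0 < S.d₃ ^ S.α := Real.rpow_pos_of_pos hd₃ _
  have hD₁' : 0 < S.d₁ ^ (2 * S.α) := Real.rpow_pos_of_pos hd₁ _
  set B := (1 - S.τ) * S.d₁ ^ (2 * S.α) * γth / (2 * S.η * S.τ) with hBdef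
  have hB : 0 < B := by positivity
  set a := S.d₁ ^ S.α / S.d₃ ^ S.α with hadef
  have ha : 0 < a := by positivity
  set b := (S.d₁ ^ S.α) ^ 2 / (S.d₂ ^ S.α) ^ 2 with hbdef
  have hb : 0 < b := by positivity
  set C := 2 * a⁻¹ / ((m + 1).factorial * (m + 1) * (m + 3)) with hCdef
  have hC : 0 < C := by positivity
  have hinf : ∀ ρ, S.outageProbInf (m + 2) γth ρ =
      C * (B / ρ) ^ ((((m + 2 : ℕ) : ℝ) + 1) / 2) := by
    intro ρ
    have hΓ : Real.Gamma ((m + 2 : ℕ) : ℝ) = (m + 1).factorial := by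
      rw [← Real.Gamma_nat_eq_factorial]
      push_cast
      ring_nf
    rw [WirelessPowered.Params.outageProbInf, hΓ, hBdef, div_div]
    congr 1
    rw [hCdef, hadef]
    push_cast
    have e1 : (m : ℝ) + 2 + 1 = m + 3 := by ring
    have e2 : (m : ℝ) + 2 - 1 = m + 1 := by ring
    rw [e1, e2]
    field_simp
  have hprob : ∀ᶠ ρ : ℝ in atTop,
      S.outageProb P h₁ h₂ h₃ (fun ω => WirelessPowered.mrt (h₁ ω)) γth ρ =
        (WirelessPowered.channelLaw (m + 2)).real
          (WirelessPowered.outageEvent (m + 2) a b γth √(B / ρ)) := by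
    filter_upwards [eventually_gt_atTop 0] with ρ hρ
    have hset := S.setOf_endToEndSNR_mrt_lt hη hτ₀ hτ₁ hd₁ hd₂ hd₃ hγ (m + 2) hρ
    have hlaw : P.map (fun ω => (h₁ ω, h₂ ω, h₃ ω)) = WirelessPowered.channelLaw (m + 2) :=
      hch.map_eq
    rw [← hlaw, map_measureReal_apply_of_aemeasurable hch.aemeasurable
      (WirelessPowered.measurableSet_outageEvent _ _ _ _ _), ← hset]
    rfl
  have hδ : Tendsto (fun ρ : ℝ => √(B / ρ)) atTop (𝓝[>] 0) := by
    refine tendsto_nhdsWithin_iff.2 ⟨?_, ?_⟩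
    · have h0 : Tendsto (fun ρ : ℝ => B / ρ) atTop (𝓝 0) := tendsto_const_nhds.div_atTop tendsto_id
      simpa using h0.sqrt
    · filter_upwards [eventually_gt_atTop 0] with ρ hρ
      exact Real.sqrt_pos.2 (div_pos hB hρ)
  have hequiv : (fun ρ : ℝ => S.outageProb P h₁ h₂ h₃ (fun ω => WirelessPowered.mrt (h₁ ω)) γth ρ)
      ~[atTop] fun ρ => C * (B / ρ) ^ ((((m + 2 : ℕ) : ℝ) + 1) / 2) := by
    rw [isEquivalent_iff_tendsto_one ((eventually_gt_atTop 0).mono fun ρ hρ => by positivity)]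
    have h := ((WirelessPowered.tendsto_channelLaw_outageEvent m ha hb hγ).comp hδ).div_const C
    rw [div_self hC.ne'] at h
    refine h.congr' ?_
    filter_upwards [hprob, eventually_gt_atTop 0] with ρ hρ hρ0
    have hpow : (B / ρ) ^ ((((m + 2 : ℕ) : ℝ) + 1) / 2) = √(B / ρ) ^ (m + 3) := by
      rw [Real.rpow_div_two_eq_sqrt _ (by positivity), ← Real.rpow_natCast]
      congr 1
      push_cast
      ring
    simp only [Function.comp_apply, Pi.div_apply]
    rw [hρ, hpow, div_div, mul_comm C]
  refine ⟨?_, WirelessPowered.hasDiversityOrder_of_isEquivalent hC hB hequiv⟩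
  simp_rw [hinf]
  exact hequiv
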